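/- Let $(R,\mathfrak m)$ be a Cohen-Macaulay local ring with $\dim R=1$. Let $\overline R$ denote the integral closure of $R$ in its total ring of fractions $\mathrm Q(R)$, and suppose that $\overline R$ is a discrete valuation ring which is finitely generated as an $R$-module. A finitely generated $R$-module $X$ is called maximal Cohen-Macaulay if $\operatorname{depth}_{R_{\mathfrak p}}X_{\mathfrak p}\ge\dim R_{\mathfrak p}$ for every $\mathfrak p\in\operatorname{Spec}R$ (the zero module having depth $\infty$), and $\Omega\mathrm{CM}(R)$ denotes the class of finitely generated $R$-modules $M$ for which there is an exact sequence $0\to M\to F\to X\to 0$ of $R$-modules with $F$ free and $X$ maximal Cohen-Macaulay. If $\mathfrak m\overline R\subseteq R$, then the set of isomorphism classes of indecomposable modules in $\Omega\mathrm{CM}(R)$ is exactly $\{[R],[\overline R]\}$; likewise, the set of isomorphism classes of indecomposable finitely generated reflexive $R$-modules is exactly $\{[R],[\overline R]\}$. (Here $M$ is reflexive if the canonical map $M\to M^{**}$, with $(-)^*=\operatorname{Hom}_R(-,R)$, is bijective, and indecomposable if it is nonzero and is not a direct sum of two nonzero submodules. If $R=\overline R$, the two classes coincide.) -/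

import Mathlib

namespace OneDimCM

universe u v

/-- The depth of a module over a local ring: the supremum of the lengths of regular sequences
on `M` consisting of elements of the maximal ideal. For a nonzero finitely generated module over a
Noetherian local ring, "weakly regular" and "regular" agree for such sequences by Nakayama's lemma;
for the zero module the value is `⊤`, as usual. -/
noncomputable def depth (R : Type*) [CommRing R] [IsLocalRing R]
    (M : Type*) [AddCommGroup M] [Module R M] : ℕ∞ :=
  ⨆ (rs : List R) (_ : ∀ r ∈ rs, r ∈ IsLocalRing.maximalIdeal R)
    (_ : RingTheory.Sequence.IsWeaklyRegular M rs), (rs.length : ℕ∞)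

/-- Cohen-Macaulay local rings: Noetherian local rings whose depth equals their Krull dimension. -/
structure IsCohenMacaulayLocalRing (R : Type*) [CommRing R] [IsLocalRing R] : Prop where
  isNoetherianRing : IsNoetherianRing R
  depth_eq_dim : (depth R R : WithBot ℕ∞) = ringKrullDim R

/-- Maximal Cohen-Macaulay modules, the objects of `CM(A)`: finitely generated modules with
`depth M_p ≥ dim A_p` for all primes `p` of `A`. -/
structure IsMaximalCohenMacaulay (A : Type*) [CommRing A]
    (M : Type*) [AddCommGroup M] [Module A M] : Prop where
  finite : Module.Finite A M
  dim_le_depth : ∀ (p : Ideal A) [p.IsPrime],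
    ringKrullDim (Localization.AtPrime p) ≤
      (depth (Localization.AtPrime p) (LocalizedModule p.primeCompl M) : WithBot ℕ∞)

/-- The objects of `ΩCM(A)`: finitely generated modules `M` admitting an exact sequence
`0 → M → F → X → 0` with `F` free and `X` maximal Cohen-Macaulay. (As `M` and `X` are finitely
generated, so is `F`; hence letting `F` and `X` live in the universe of `A` loses nothing.) -/
def IsSyzygyOfMCM (A : Type u) [CommRing A] (M : Type v) [AddCommGroup M] [Module A M] : Prop :=
  Module.Finite A M ∧
    ∃ (F : Type u) (_ : AddCommGroup F) (_ : Module A F)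
      (X : Type u) (_ : AddCommGroup X) (_ : Module A X)
      (f : M →ₗ[A] F) (g : F →ₗ[A] X),
      Module.Free A F ∧ IsMaximalCohenMacaulay A X ∧
        Function.Injective f ∧ Function.Exact f g ∧ Function.Surjective g

/-- Indecomposable modules: nonzero modules that are not the (internal) direct sum of two nonzero
submodules. -/
def IsIndecomposable (A : Type*) [CommRing A] (M : Type*) [AddCommGroup M] [Module A M] : Prop :=
  Nontrivial M ∧ ∀ N₁ N₂ : Submodule A M, IsCompl N₁ N₂ → N₁ = ⊥ ∨ N₂ = ⊥

end OneDimCM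

namespace OneDimCM

open IsLocalRing Module

universe u v w

/-! ### Direct-sum decompositions and splitting criteria. -/

section Indecomposable

variable {A : Type*} [CommRing A] {M : Type*} [AddCommGroup M] [Module A M]
  {N : Type*} [AddCommGroup N] [Module A N]

/-! Write S for the integral closure. R embeds in S, so it is a one-dimensional local domain, and
its maximal Cohen-Macaulay modules are the finitely generated torsion-free ones. Dualizing a free
cover of M* puts a reflexive M in ΩCM(R) (`IsSyzygyOfMCM.of_isReflexive`). Now let 0 → M → F → X → 0
have M indecomposable. If some coordinate of F takes a unit value on M, R splits off and M ≅ R.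
Otherwise M ⊆ 𝔪F, so sM ⊆ F for s in S, and torsion-freeness of X forces sM ⊆ M. Thus M is finitely
generated and torsion-free over the principal ideal domain S, hence free, hence M ≅ S
(`IsSyzygyOfMCM.nonempty_equiv_or`). Conversely R and S are indecomposable of rank one, and S is
reflexive (`isReflexive_of_maximalIdeal_mul_mem`), which closes the circle for both classes. -/

lemma IsIndecomposable.congr (e : M ≃ₗ[A] N) (h : IsIndecomposable A M) :
    IsIndecomposable A N := by
  obtain ⟨hn, h⟩ := h
  refine ⟨e.symm.toEquiv.nontrivial, fun N₁ N₂ hc => ?_⟩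
  have hc' := hc.map (Submodule.orderIsoMapComap e.symm)
  simpa using h _ _ hc'

lemma IsIndecomposable.subsingleton_or_of_equiv_prod {P : Type*} [AddCommGroup P] [Module A P]
    (h : IsIndecomposable A M) (e : M ≃ₗ[A] N × P) : Subsingleton N ∨ Subsingleton P := by
  have key := (h.congr e).2 _ _ (LinearMap.isCompl_range_inl_inr (R := A) (M := N) (M₂ := P))
  refine key.imp (fun hb => ?_) fun hb => ?_
  · rw [LinearMap.range_eq_bot] at hb
    exact subsingleton_of_forall_eq 0 fun x => by simpa using LinearMap.congr_fun hb x
  · rw [LinearMap.range_eq_bot] at hb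
    exact subsingleton_of_forall_eq 0 fun x => by simpa using LinearMap.congr_fun hb x

lemma IsIndecomposable.nonempty_equiv_of_equiv_pi (h : IsIndecomposable A M) [Nontrivial N]
    {n : ℕ} (e : M ≃ₗ[A] (Fin n → N)) : Nonempty (M ≃ₗ[A] N) := by
  obtain _ | n := n
  · have := h.1
    exact absurd e.toEquiv.symm.nontrivial (not_nontrivial _)
  · have e' : M ≃ₗ[A] N × (Fin n → N) := e.trans (Fin.consLinearEquiv A fun _ => N).symm
    rcases h.subsingleton_or_of_equiv_prod e' with hs | hs
    · exact absurd ‹Nontrivial N› (not_nontrivial_iff_subsingleton.mpr hs)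
    · have := uniqueOfSubsingleton (0 : Fin n → N)
      exact ⟨e'.trans LinearEquiv.prodUnique⟩

/-- An indecomposable module with a free rank one quotient is free of rank one. -/
lemma IsIndecomposable.nonempty_equiv_of_surjective [Nontrivial A] (h : IsIndecomposable A M)
    (f : M →ₗ[A] A) (hf : Function.Surjective f) : Nonempty (M ≃ₗ[A] A) := by
  obtain ⟨g, hg⟩ := LinearMap.exists_rightInverse_of_surjective f (LinearMap.range_eq_top.mpr hf)
  have hfg : ∀ a, f (g a) = a := LinearMap.congr_fun hg
  have hc : IsCompl (LinearMap.range g) (LinearMap.ker f) := by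
    refine ⟨Submodule.disjoint_def.mpr ?_, Submodule.codisjoint_iff_exists_add_eq.mpr fun x => ?_⟩
    · rintro _ ⟨a, rfl⟩ ha
      rw [LinearMap.mem_ker, hfg] at ha
      rw [ha, map_zero]
    · exact ⟨g (f x), x - g (f x), ⟨f x, rfl⟩, by simp [hfg], by abel⟩
  rcases h.2 _ _ hc with hb | hb
  · rw [LinearMap.range_eq_bot] at hb
    have := hfg 1
    simp [hb] at this
  · exact ⟨LinearEquiv.ofBijective f ⟨LinearMap.ker_eq_bot.mp hb, hf⟩⟩

end Indecomposable

/-! ### Indecomposability in rank one. -/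

section RankOne

variable {R : Type u} [CommRing R] {S : Type w} [CommRing S] [Algebra R S] [FaithfulSMul R S]

/-- A faithful domain `S` over `R` with `a S ⊆ R` for some nonzero `a` has rank one over `R`. -/
lemma isIndecomposable_of_smul_mem [IsDomain S] {a : R} (ha : a ≠ 0)
    (h : ∀ s : S, ∃ d : R, algebraMap R S d = algebraMap R S a * s) :
    IsIndecomposable R S := by
  refine ⟨inferInstance, fun N₁ N₂ hc => ?_⟩
  by_contra! hne
  obtain ⟨x, hx, hx0⟩ := Submodule.exists_mem_ne_zero_of_ne_bot hne.1
  obtain ⟨y, hy, hy0⟩ := Submodule.exists_mem_ne_zero_of_ne_bot hne.2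
  obtain ⟨c, hc'⟩ := h x
  obtain ⟨d, hd⟩ := h y
  have ha' : algebraMap R S a ≠ 0 := by simpa using ha
  -- Both `a * x` and `a * y` come from `R`, so `a * x * y` is an `R`-multiple of `y` and of `x`.
  have h₁ : algebraMap R S a * x * y ∈ N₁ := by
    have := N₁.smul_mem d hx
    rw [Algebra.smul_def, hd] at this
    convert this using 1; ring
  have h₂ : algebraMap R S a * x * y ∈ N₂ := by
    have := N₂.smul_mem c hy
    rwa [Algebra.smul_def, hc'] at this
  have := Submodule.disjoint_def.mp hc.disjoint _ h₁ h₂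
  simp [ha', hx0, hy0] at this

end RankOne

/-! ### Torsion-free, maximal Cohen-Macaulay and reflexive modules. -/

section Syzygy

variable {R : Type u} [CommRing R] [IsLocalRing R] [IsDomain R]

/-- Positive depth at the maximal ideal yields an `X`-regular `a` there. In dimension one every
nonzero `r` in the maximal ideal divides a power of `a`, so `r` is regular too. -/
lemma IsMaximalCohenMacaulay.isTorsionFree [IsNoetherianRing R] (hdim : ringKrullDim R = 1)
    {X : Type v} [AddCommGroup X] [Module R X] (h : IsMaximalCohenMacaulay R X) :
    IsTorsionFree R X := by
  set m := maximalIdeal R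
  have hd := h.dim_le_depth m
  rw [IsLocalization.AtPrime.ringKrullDim_eq_height m, maximalIdeal_height_eq_ringKrullDim,
    hdim] at hd
  have hd' : (0 : ℕ∞) < depth (Localization.AtPrime m) (LocalizedModule m.primeCompl X) :=
    lt_of_lt_of_le zero_lt_one (by exact_mod_cast hd)
  simp only [depth, lt_iSup_iff] at hd'
  obtain ⟨rs, hrs, hreg, hlen⟩ := hd'
  obtain _ | ⟨q, rs⟩ := rs
  · simp at hlen
  have hq : IsSMulRegular (LocalizedModule m.primeCompl X) q :=
    ((RingTheory.Sequence.isWeaklyRegular_cons_iff _ _ _).mp hreg).1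
  have hqm := hrs q (by simp)
  obtain ⟨a, s, rfl⟩ := IsLocalization.exists_mk'_eq m.primeCompl q
  rw [IsLocalization.mk'_mem_iff, IsLocalization.AtPrime.to_map_mem_maximal_iff _ m] at hqm
  have hareg : ∀ x : X, a • x = 0 → x = 0 := by
    intro x hx
    have hx' : LocalizedModule.mkLinearMap m.primeCompl X x = 0 := by
      refine isSMulRegular_iff_right_eq_zero_of_smul.mp hq _ ?_
      rw [LocalizedModule.mkLinearMap_apply, ← Localization.mk_eq_mk', LocalizedModule.mk_smul_mk,
        hx, LocalizedModule.zero_mk]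
    obtain ⟨t, ht⟩ := (IsLocalizedModule.eq_zero_iff m.primeCompl _).mp hx'
    have htu : IsUnit (t : R) := not_not.mp t.2
    exact htu.smul_eq_zero.mp ht
  have hkd : Ring.KrullDimLE 1 R := Ring.krullDimLE_iff.mpr hdim.le
  refine .of_smul_eq_zero fun r x hrx => or_iff_not_imp_left.mpr fun hr => ?_
  have har : a ∈ (Ideal.span {r}).radical := by
    rw [Ideal.radical_eq_sInf, Ideal.mem_sInf]
    rintro J ⟨hJ, hJp⟩
    have hJ0 : J ≠ ⊥ := fun h0 => hr (by simpa [h0] using hJ)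
    have hJm := hJp.isMaximal_of_ne_bot hJ0
    rwa [eq_maximalIdeal hJm]
  obtain ⟨k, hk⟩ := har
  obtain ⟨c, hc⟩ := Ideal.mem_span_singleton'.mp hk
  have hkx : a ^ k • x = 0 := by rw [← hc, mul_smul, hrx, smul_zero]
  clear hk hc
  induction k with
  | zero => simpa using hkx
  | succ k ih => exact ih (hareg _ (by rwa [← mul_smul, ← pow_succ']))

/-- Nonzero primes have height at most one, and any nonzero element of such a prime is a regular
sequence of length one. -/
lemma IsMaximalCohenMacaulay.of_isTorsionFree (hdim : ringKrullDim R = 1)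
    {X : Type v} [AddCommGroup X] [Module R X] [Module.Finite R X] [IsTorsionFree R X] :
    IsMaximalCohenMacaulay R X := by
  refine ⟨inferInstance, fun p hp => ?_⟩
  rw [IsLocalization.AtPrime.ringKrullDim_eq_height p]
  by_cases hp0 : p = ⊥
  · subst hp0
    simp
  obtain ⟨a, hap, ha⟩ := Submodule.exists_mem_ne_zero_of_ne_bot hp0
  have hle : (p.height : WithBot ℕ∞) ≤ 1 := hdim ▸ Ideal.height_le_ringKrullDim_of_ne_top hp.ne_top
  refine hle.trans ?_
  suffices h : (1 : ℕ∞) ≤ depth (Localization.AtPrime p) (LocalizedModule p.primeCompl X) by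
    exact_mod_cast h
  refine le_iSup_of_le [algebraMap R _ a] (le_iSup_of_le ?_ (le_iSup_of_le ?_ (by simp)))
  · simpa using (IsLocalization.AtPrime.to_map_mem_maximal_iff _ p a).mpr hap
  · rw [RingTheory.Sequence.isWeaklyRegular_singleton_iff,
      isSMulRegular_iff_right_eq_zero_of_smul]
    intro y hy
    induction y with
    | h x s =>
      rw [algebraMap_smul, LocalizedModule.smul'_mk, ← LocalizedModule.zero_mk s,
        LocalizedModule.mk_eq] at hy
      obtain ⟨t, ht⟩ := hy
      simp only [smul_zero, Submonoid.smul_def, smul_eq_zero, ha, false_or] at ht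
      have h0 : ∀ t : p.primeCompl, (t : R) ≠ 0 := fun t ht => t.2 (ht ▸ p.zero_mem)
      rw [(ht.resolve_left (h0 t)).resolve_left (h0 s), LocalizedModule.zero_mk]

/-- Finitely generated reflexive modules are syzygies of maximal Cohen-Macaulay modules. -/
lemma IsSyzygyOfMCM.of_isReflexive [IsNoetherianRing R] (hdim : ringKrullDim R = 1)
    (M : Type v) [AddCommGroup M] [Module R M] [Module.Finite R M] [IsReflexive R M] :
    IsSyzygyOfMCM R M := by
  obtain ⟨n, π, hπ⟩ := Module.Finite.exists_fin' R (Dual R M)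
  -- The transpose of `π`, after evaluation `M → M**`.
  let f : M →ₗ[R] (Fin n → R) := LinearMap.pi fun i => π (Pi.single i 1)
  have hf : ∀ x (k : Fin n → R), π k x = ∑ i, k i * f x i := by
    intro x k
    conv_lhs => rw [pi_eq_sum_univ' k]
    simp [f]
  have hinj : Function.Injective f := by
    intro x y hxy
    refine (bijective_dual_eval R M).1 (LinearMap.ext fun φ => ?_)
    obtain ⟨k, rfl⟩ := hπ φ
    simp [hf, hxy]
  have htf : IsTorsionFree R ((Fin n → R) ⧸ LinearMap.range f) := by
    refine .of_smul_eq_zero fun r y hy => or_iff_not_imp_left.mpr fun hr => ?_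
    obtain ⟨y, rfl⟩ := Submodule.Quotient.mk_surjective _ y
    rw [← Submodule.Quotient.mk_smul, Submodule.Quotient.mk_eq_zero] at hy
    obtain ⟨x, hx⟩ := hy
    rw [Submodule.Quotient.mk_eq_zero]
    -- Pairing with `y`. Since `r • y = f x`, `ψ` kills `ker π` and descends to `M*`; by reflexivity
    -- it is evaluation at some `z`, and then `f z = y`.
    let ψ : (Fin n → R) →ₗ[R] R := Fintype.linearCombination R y
    have hψ : ∀ k, r * ψ k = π k x := by
      intro k
      rw [hf, hx]
      simp only [ψ, Fintype.linearCombination_apply, smul_eq_mul, Finset.mul_sum, Pi.smul_apply]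
      exact Finset.sum_congr rfl fun _ _ => by ring
    have hker : LinearMap.ker π ≤ LinearMap.ker ψ := by
      intro k hk
      have := hψ k
      rw [LinearMap.mem_ker.mp hk, LinearMap.zero_apply] at this
      exact (mul_eq_zero.mp this).resolve_left hr
    let e := π.quotKerEquivOfSurjective hπ
    obtain ⟨z, hz⟩ := (bijective_dual_eval R M).2 ((LinearMap.ker π).liftQ ψ hker ∘ₗ e.symm)
    have hz' : ∀ k, π k z = ψ k := by
      intro k
      have := LinearMap.congr_fun hz (π k)
      have he : e.symm (π k) = Submodule.Quotient.mk k := by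
        rw [LinearEquiv.symm_apply_eq]; rfl
      simpa [he] using this
    refine ⟨z, funext fun i => ?_⟩
    change π (Pi.single i 1) z = y i
    simp [hz', ψ, Fintype.linearCombination_apply_single]
  exact ⟨inferInstance, Fin n → R, inferInstance, inferInstance, (Fin n → R) ⧸ LinearMap.range f,
    inferInstance, inferInstance, f, (LinearMap.range f).mkQ, inferInstance,
    .of_isTorsionFree hdim, hinj, LinearMap.exact_map_mkQ_range f, Submodule.mkQ_surjective _⟩

end Syzygy

/-! ### Modules over the overring `S`. -/

section Overring

variable {R : Type u} [CommRing R] [IsLocalRing R] {S : Type w} [CommRing S]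
  [Algebra R S] [FaithfulSMul R S]

/-- If `a * s` were a unit, `a` would be a unit in `S`, hence in `R` by integrality. -/
lemma exists_mem_maximalIdeal_algebraMap_eq_mul [Algebra.IsIntegral R S]
    (hm : ∀ a ∈ maximalIdeal R, ∀ s : S, ∃ d : R, algebraMap R S d = algebraMap R S a * s)
    {a : R} (ha : a ∈ maximalIdeal R) (s : S) :
    ∃ d ∈ maximalIdeal R, algebraMap R S d = algebraMap R S a * s := by
  obtain ⟨d, hd⟩ := hm a ha s
  refine ⟨d, fun hu => ha ?_, hd⟩
  have : IsUnit (algebraMap R S a) := isUnit_of_mul_isUnit_left (hd ▸ hu.map (algebraMap R S))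
  exact isUnit_of_map_unit _ _ this

/-- The maximal ideal is an ideal `aS` of `S`, and functionals on `S` are multiplications by
elements of `R`. A functional `φ` on `S*` is thus determined by its value at `μ`, multiplication by
`a`: if `φ μ = a * q`, then `φ` is evaluation at `q`. -/
lemma isReflexive_of_maximalIdeal_mul_mem [IsDomain S] [IsPrincipalIdealRing S] [Algebra.IsIntegral R S]
    (hR : maximalIdeal R ≠ ⊥)
    (hm : ∀ a ∈ maximalIdeal R, ∀ s : S, ∃ d : R, algebraMap R S d = algebraMap R S a * s) :
    IsReflexive R S := by
  have hinj := FaithfulSMul.algebraMap_injective R S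
  have hm' := fun {a} (ha : a ∈ maximalIdeal R) =>
    exists_mem_maximalIdeal_algebraMap_eq_mul hm ha
  let I : Ideal S :=
    { carrier := algebraMap R S '' maximalIdeal R
      add_mem' := by
        rintro _ _ ⟨x, hx, rfl⟩ ⟨y, hy, rfl⟩
        exact ⟨x + y, add_mem hx hy, map_add _ _ _⟩
      zero_mem' := ⟨0, zero_mem _, map_zero _⟩
      smul_mem' := by
        rintro s _ ⟨x, hx, rfl⟩
        obtain ⟨d, hd, hds⟩ := hm' hx s
        exact ⟨d, hd, by rw [hds, smul_eq_mul, mul_comm]⟩ }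
  obtain ⟨a, ha, hag⟩ : Submodule.IsPrincipal.generator I ∈ algebraMap R S '' maximalIdeal R :=
    Submodule.IsPrincipal.generator_mem I
  have hdvd : ∀ b ∈ maximalIdeal R, ∃ q, algebraMap R S b = algebraMap R S a * q := by
    intro b hb
    have : algebraMap R S b ∈ I := ⟨b, hb, rfl⟩
    obtain ⟨q, hq⟩ := (Submodule.IsPrincipal.mem_iff_eq_smul_generator I).mp this
    exact ⟨q, by rw [hq, hag, smul_eq_mul, mul_comm]⟩
  have ha0 : a ≠ 0 := by
    rintro rfl
    refine hR (eq_bot_iff.mpr fun b hb => ?_)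
    obtain ⟨q, hq⟩ := hdvd b hb
    rw [Ideal.mem_bot]
    exact hinj (by rw [hq]; simp)
  have ha0' : algebraMap R S a ≠ 0 := by simpa using ha0
  have hmul : ∀ b ∈ maximalIdeal R, ∃ μ : Dual R S, ∀ s,
      algebraMap R S (μ s) = algebraMap R S b * s := by
    intro b hb
    choose d hd using hm b hb
    refine ⟨⟨⟨d, fun x y => hinj ?_⟩, fun r x => hinj ?_⟩, hd⟩
    · rw [map_add, hd, hd, hd, mul_add]
    · rw [RingHom.id_apply, smul_eq_mul, map_mul, hd, hd, Algebra.smul_def]; ring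
  obtain ⟨μ, hμ⟩ := hmul a ha
  have hcancel : ∀ {x y : R}, a * x = a * y → x = y := fun {x y} hxy => hinj <|
    mul_left_cancel₀ ha0' (by rw [← map_mul, ← map_mul, hxy])
  have hfa : ∀ (f : Dual R S) s, algebraMap R S (f s) = algebraMap R S (f 1) * s := by
    intro f s
    refine mul_left_cancel₀ ha0' ?_
    obtain ⟨d, hd⟩ := hm a ha s
    have : a * f s = d * f 1 := by
      rw [← smul_eq_mul, ← smul_eq_mul, ← map_smul, ← map_smul, Algebra.smul_def,
        Algebra.smul_def, hd, mul_one]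
    rw [← map_mul, this, map_mul, hd]; ring
  refine ⟨⟨fun x y hxy => ?_, fun φ => ?_⟩⟩
  · have := congrArg (algebraMap R S) (LinearMap.congr_fun hxy μ)
    simp only [Dual.eval_apply, hμ] at this
    exact mul_left_cancel₀ ha0' this
  · by_cases hc : φ μ ∈ maximalIdeal R
    · obtain ⟨q, hq⟩ := hdvd _ hc
      refine ⟨q, LinearMap.ext fun f => hcancel ?_⟩
      have h₁ : a • f = f 1 • μ := LinearMap.ext fun s => hinj <| by
        simp only [LinearMap.smul_apply, smul_eq_mul, map_mul, hμ, hfa f s]; ring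
      have h₂ : a * φ f = f 1 * φ μ := by
        rw [← smul_eq_mul, ← smul_eq_mul, ← map_smul, h₁, map_smul]
      rw [h₂]
      refine hinj ?_
      rw [Dual.eval_apply, map_mul, map_mul, hq, hfa f q]; ring
    -- A unit value is possible only if `S = R`: comparing `φ` at `μ` and at multiplication by `a *
    -- s` gives `s` as a quotient in `R`.
    · have hcu : IsUnit (φ μ) := by simpa using hc
      obtain ⟨c, hc⟩ := hcu.exists_left_inv
      have hsurj : Function.Surjective (algebraMap R S) := by
        intro s
        obtain ⟨d, hd, hds⟩ := hm' ha s
        obtain ⟨ν, hν⟩ := hmul d hd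
        refine ⟨c * φ ν, mul_left_cancel₀ ha0' ?_⟩
        have h₁ : a • ν = d • μ := LinearMap.ext fun t => hinj <| by
          simp only [LinearMap.smul_apply, smul_eq_mul, map_mul, hμ, hν]; ring
        have h₂ : a * φ ν = d * φ μ := by
          rw [← smul_eq_mul, ← smul_eq_mul, ← map_smul, h₁, map_smul]
        rw [← map_mul, mul_left_comm, h₂, mul_left_comm, hc, mul_one, hds]
      have : IsReflexive R S :=
        Module.equiv (LinearEquiv.ofBijective (Algebra.linearMap R S) ⟨hinj, hsurj⟩)
      exact (bijective_dual_eval R S).2 φ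

/-- An indecomposable syzygy `M` of a maximal Cohen-Macaulay module either maps onto `R`, or is
contained in `𝔪F` and is then stable under multiplication by `S`. -/
lemma IsSyzygyOfMCM.nonempty_equiv_or [IsDomain R] [IsNoetherianRing R]
    [IsDomain S] [IsPrincipalIdealRing S] (hdim : ringKrullDim R = 1) (hR : maximalIdeal R ≠ ⊥)
    (hm : ∀ a ∈ maximalIdeal R, ∀ s : S, ∃ d : R, algebraMap R S d = algebraMap R S a * s)
    {M : Type v} [AddCommGroup M] [Module R M] (h : IsSyzygyOfMCM R M)
    (hM : IsIndecomposable R M) : Nonempty (M ≃ₗ[R] R) ∨ Nonempty (M ≃ₗ[R] S) := by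
  classical
  obtain ⟨hfin, F, _, _, X, _, _, f, g, hfree, hX, hf, hfg, hg⟩ := h
  have hinj := FaithfulSMul.algebraMap_injective R S
  have hXtf := hX.isTorsionFree hdim
  obtain ⟨a, ha, ha0⟩ := Submodule.exists_mem_ne_zero_of_ne_bot hR
  obtain ⟨ι, b⟩ := hfree.exists_basis.some
  by_cases hunit : ∃ i x, IsUnit (b.repr (f x) i)
  · obtain ⟨i, x, hu⟩ := hunit
    refine .inl (hM.nonempty_equiv_of_surjective (b.coord i ∘ₗ f) fun r => ?_)
    obtain ⟨c, hc⟩ := hu.exists_left_inv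
    exact ⟨(r * c) • x, by simp [mul_assoc, hc]⟩
  push Not at hunit
  have hmem : ∀ i x, b.repr (f x) i ∈ maximalIdeal R := fun i x => by simpa using hunit i x
  let j : M →ₗ[R] (ι →₀ S) :=
    Finsupp.mapRange.linearMap (Algebra.linearMap R S) ∘ₗ b.repr.toLinearMap ∘ₗ f
  have hj : ∀ x i, j x i = algebraMap R S (b.repr (f x) i) := fun x i => by simp [j]
  have hjinj : Function.Injective j := by
    intro x y hxy
    refine hf (b.repr.injective (Finsupp.ext fun i => hinj ?_))
    rw [← hj, ← hj, hxy]
  have hstable : ∀ (s : S) x, ∃ y, j y = s • j x := by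
    intro s x
    choose d hd using fun i => hm _ (hmem i x) s
    have hd0 : ∀ i, d i ≠ 0 → i ∈ (b.repr (f x)).support := by
      intro i hi
      rw [Finsupp.mem_support_iff]
      intro h0
      have := hd i
      rw [h0, map_zero, zero_mul] at this
      exact hi (hinj (by rw [this, map_zero]))
    let z : F := b.repr.symm (Finsupp.onFinset _ d hd0)
    have hz : ∀ i, b.repr z i = d i := fun i => by simp [z]
    -- With `r = a * s`, `a • z = r • f x` dies in `X`; cancelling `a` there puts `z` in the image
    -- of `M`.
    obtain ⟨r, hr⟩ := hm a ha s
    have hzx : a • z = r • f x := by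
      refine b.repr.injective (Finsupp.ext fun i => hinj ?_)
      simp only [map_smul, Finsupp.smul_apply, smul_eq_mul, map_mul, hz, hd, hr]
      ring
    have hgz : a • g z = 0 := by
      rw [← map_smul, hzx, map_smul, hfg.apply_apply_eq_zero, smul_zero]
    obtain ⟨y, hy⟩ := (hfg z).mp ((smul_eq_zero.mp hgz).resolve_left ha0)
    refine ⟨y, Finsupp.ext fun i => ?_⟩
    rw [hj, hy, hz, hd, Finsupp.smul_apply, hj, smul_eq_mul, mul_comm]
  let N : Submodule S (ι →₀ S) :=
    { carrier := Set.range j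
      add_mem' := by
        rintro _ _ ⟨x, rfl⟩ ⟨y, rfl⟩
        exact ⟨x + y, map_add _ _ _⟩
      zero_mem' := ⟨0, map_zero _⟩
      smul_mem' := by
        rintro s _ ⟨x, rfl⟩
        exact hstable s x }
  let e : M ≃ₗ[R] N := LinearEquiv.ofBijective
    (⟨⟨fun x => ⟨j x, x, rfl⟩, fun x y => Subtype.ext (map_add j x y)⟩,
      fun r x => Subtype.ext (map_smul j r x)⟩ : M →ₗ[R] N)
    ⟨fun x y hxy => hjinj (congrArg Subtype.val hxy), by
      rintro ⟨_, x, rfl⟩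
      exact ⟨x, rfl⟩⟩
  have hNR : Module.Finite R N := Module.Finite.equiv e
  have hNS : Module.Finite S N := Module.Finite.of_restrictScalars_finite R S N
  obtain ⟨n, bN⟩ := Module.basisOfFiniteTypeTorsionFree' (R := S) (M := N)
  exact .inr (hM.nonempty_equiv_of_equiv_pi (e.trans (bN.equivFun.restrictScalars R)))

end Overring

end OneDimCM

/-! ### The classification. -/

open OneDimCM IsLocalRing in
theorem proposition4p4 (R : Type*) [CommRing R] [IsLocalRing R]
    (hCM : OneDimCM.IsCohenMacaulayLocalRing R) (hdim : ringKrullDim R = 1)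
    [IsDomain (integralClosure R (FractionRing R))]
    [IsDiscreteValuationRing (integralClosure R (FractionRing R))]
    (hfin : Module.Finite R (integralClosure R (FractionRing R)))
    (hm : ∀ a ∈ IsLocalRing.maximalIdeal R, ∀ x ∈ integralClosure R (FractionRing R),
      a • x ∈ (algebraMap R (FractionRing R)).range)
    (M : Type*) [AddCommGroup M] [Module R M] :
    -- indecomposable objects of `ΩCM(R)`, up to isomorphism
    ((OneDimCM.IsSyzygyOfMCM R M ∧ OneDimCM.IsIndecomposable R M) ↔
      (Nonempty (M ≃ₗ[R] R) ∨ Nonempty (M ≃ₗ[R] integralClosure R (FractionRing R)))) ∧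
    -- indecomposable finitely generated reflexive modules, up to isomorphism
    ((Module.Finite R M ∧ Module.IsReflexive R M ∧ OneDimCM.IsIndecomposable R M) ↔
      (Nonempty (M ≃ₗ[R] R) ∨ Nonempty (M ≃ₗ[R] integralClosure R (FractionRing R)))) := by
  have := hCM.isNoetherianRing
  set S := integralClosure R (FractionRing R) with hS
  have hinj : Function.Injective (algebraMap R S) := fun x y hxy =>
    IsFractionRing.injective R (FractionRing R) (congrArg Subtype.val hxy)
  have : FaithfulSMul R S := (faithfulSMul_iff_algebraMap_injective R S).mpr hinj
  have : IsDomain R := hinj.isDomain (algebraMap R S)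
  have hR : maximalIdeal R ≠ ⊥ := by
    intro h0
    have := maximalIdeal_height_eq_ringKrullDim (R := R)
    rw [h0, Ideal.height_bot, hdim] at this
    exact absurd this (by norm_num)
  have hm' : ∀ a ∈ maximalIdeal R, ∀ s : S, ∃ d : R,
      algebraMap R S d = algebraMap R S a * s := by
    intro a ha s
    obtain ⟨d, hd⟩ := hm a ha s s.2
    refine ⟨d, Subtype.ext ?_⟩
    rw [← Algebra.smul_def]
    exact hd
  have hSr : Module.IsReflexive R S := isReflexive_of_maximalIdeal_mul_mem hR hm'
  obtain ⟨a, ha, ha0⟩ := Submodule.exists_mem_ne_zero_of_ne_bot hR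
  have hSi : IsIndecomposable R S := isIndecomposable_of_smul_mem ha0 (hm' a ha)
  have hRi : IsIndecomposable R R := isIndecomposable_of_smul_mem ha0 fun s => ⟨a * s, rfl⟩
  have mem : (Nonempty (M ≃ₗ[R] R) ∨ Nonempty (M ≃ₗ[R] S)) →
      Module.Finite R M ∧ Module.IsReflexive R M ∧ IsIndecomposable R M := by
    rintro (⟨⟨e⟩⟩ | ⟨⟨e⟩⟩)
    · exact ⟨.equiv e.symm, Module.equiv e.symm, hRi.congr e.symm⟩
    · exact ⟨.equiv e.symm, Module.equiv e.symm, hSi.congr e.symm⟩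
  have classify : IsSyzygyOfMCM R M ∧ IsIndecomposable R M →
      Nonempty (M ≃ₗ[R] R) ∨ Nonempty (M ≃ₗ[R] S) :=
    fun h => h.1.nonempty_equiv_or hdim hR hm' h.2
  have syz : Module.Finite R M ∧ Module.IsReflexive R M ∧ IsIndecomposable R M →
      IsSyzygyOfMCM R M ∧ IsIndecomposable R M := by
    rintro ⟨_, _, hi⟩
    exact ⟨.of_isReflexive hdim M, hi⟩
  exact ⟨⟨classify, fun h => syz (mem h)⟩, ⟨fun h => classify (syz h), mem⟩⟩
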